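/- Let $G$ be a locally compact (Hausdorff) group with left Haar measure $m$, and let $1<q<\infty$. For a complex Banach space $E$, $n\in\mathbb N$, $\lambda=(\lambda_1,\dots,\lambda_n)\in (E')^n$ and $x=(x_1,\dots,x_n)\in E^n$, put $$\mu_{1,n}(\lambda)=\sup\Big\{\sum_{i=1}^n|\langle \lambda_i,\Phi\rangle| : \Phi\in E'',\ \|\Phi\|\le 1\Big\},\qquad \|x\|_n^{(1,q)}=\sup\Big\{\Big(\sum_{i=1}^n|\langle x_i,\lambda_i\rangle|^q\Big)^{1/q} : \lambda\in(E')^n,\ \mu_{1,n}(\lambda)\le 1\Big\}.$$ The group $G$ acts on $L^1(G)=L^1(G,m)$ by $(s\cdot f)(t)=f(s^{-1}t)$, and on $L^1(G)''$ by taking second adjoints. Suppose that $G$ is $(1,q)$-amenable, that is, there is a mean $\Lambda\in L^1(G)''$ (meaning $\langle 1,\Lambda\rangle=\|\Lambda\|=1$, where $1\in L^1(G)'$ is the functional $f\mapsto\int_G f\,dm$) such that $$\sup\big\{\|(s_1\cdot\Lambda,\dots,s_n\cdot\Lambda)\|_n^{(1,q)} : n\in\mathbb N,\ s_1,\dots,s_n\in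 G\big\}<\infty,$$ the norms being those for $E=L^1(G)''$. Then: (i) there is a constant $C\ge 1$ such that for every $n\in\mathbb N$ and every $n$-element set $F\subset G$ there is a compact set $S\subset G$ with $m(S)\neq 0$ and $$\frac{m(FS)}{m(S)}\le C\,n^{1-1/q};$$ (ii) for each $\varepsilon>0$ there is $n_0\in\mathbb N$ such that for all $n\ge n_0$ and every $n$-element set $F\subset G$ there is a compact set $S\subset G$ with $m(S)\neq 0$ and $$\frac{m(FS)}{m(S)}\le\varepsilon n.$$ -/

import Mathlib

open MeasureTheory
open scoped Pointwise

noncomputable section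

namespace MultiNorm

variable {E : Type*} [NormedAddCommGroup E] [NormedSpace ℂ E]

/-- The weak `p`-summing norm `μ_{p,n}(x)` of `x ∈ Eⁿ`: the supremum of
`(∑ᵢ |⟨xᵢ, φ⟩|ᵖ)^{1/p}` over all `φ` in the closed unit ball of the dual space `E'`. -/
def weakSummingNorm (p : ℝ) {n : ℕ} (x : Fin n → E) : ℝ :=
  sSup {r : ℝ | ∃ φ : StrongDual ℂ E, ‖φ‖ ≤ 1 ∧ r = (∑ i, ‖φ (x i)‖ ^ p) ^ (1 / p)}

/-- The weak `(p,q)`-multi-norm `‖x‖ₙ^{(p,q)}` of `x ∈ Eⁿ`: the supremum of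
`(∑ᵢ |⟨xᵢ, φᵢ⟩|^q)^{1/q}` over all `φ ∈ (E')ⁿ` with `μ_{p,n}(φ) ≤ 1`. -/
def weakMultiNorm (p q : ℝ) {n : ℕ} (x : Fin n → E) : ℝ :=
  sSup {r : ℝ | ∃ φ : Fin n → StrongDual ℂ E,
    weakSummingNorm p φ ≤ 1 ∧ r = (∑ i, ‖φ i (x i)‖ ^ q) ^ (1 / q)}

/-- A subset `B` of `E` is multi-bounded in the weak `(p,q)`-multi-norm if the norms
`‖(x₁,…,xₙ)‖ₙ^{(p,q)}`, for `n ∈ ℕ` and `x₁,…,xₙ ∈ B`, are bounded. -/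
def IsMultiBounded (p q : ℝ) (B : Set E) : Prop :=
  BddAbove {r : ℝ | ∃ (n : ℕ) (x : Fin n → E), (∀ i, x i ∈ B) ∧ r = weakMultiNorm p q x}

/-- The supremum in `weakSummingNorm` is over a bounded set. -/
lemma bddAbove_weakSummingNorm {p : ℝ} (hp : 1 ≤ p) {n : ℕ} (x : Fin n → E) :
    BddAbove {r : ℝ | ∃ φ : StrongDual ℂ E, ‖φ‖ ≤ 1 ∧
      r = (∑ i, ‖φ (x i)‖ ^ p) ^ (1 / p)} := by
  refine ⟨(∑ i, ‖x i‖ ^ p) ^ (1 / p), ?_⟩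
  rintro r ⟨φ, hφ, rfl⟩
  refine Real.rpow_le_rpow (by positivity) (Finset.sum_le_sum fun i _ => ?_) (by positivity)
  refine Real.rpow_le_rpow (by positivity) ?_ (by positivity)
  simpa using φ.le_of_opNorm_le hφ (x i)

/-- The coordinates of `x` are bounded in norm by its weak `p`-summing norm. -/
lemma norm_le_weakSummingNorm {p : ℝ} (hp : 1 ≤ p) {n : ℕ} (x : Fin n → E) (i : Fin n) :
    ‖x i‖ ≤ weakSummingNorm p x := by
  obtain ⟨φ, hφ, hx⟩ := exists_dual_vector'' ℂ (x i)
  have hp0 : 0 < p := by linarith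
  refine le_trans ?_ (le_csSup (bddAbove_weakSummingNorm hp x) ⟨φ, hφ, rfl⟩)
  have h1 : ‖x i‖ = (‖φ (x i)‖ ^ p) ^ (1 / p) := by
    rw [← Real.rpow_mul (norm_nonneg _), mul_one_div_cancel hp0.ne', Real.rpow_one, hx]
    simp
  rw [h1]
  refine Real.rpow_le_rpow (by positivity) ?_ (by positivity)
  exact Finset.single_le_sum (f := fun j => ‖φ (x j)‖ ^ p)
    (fun j _ => by positivity) (Finset.mem_univ i)

/-- The supremum in `weakMultiNorm` is over a bounded set. -/
lemma bddAbove_weakMultiNorm {p q : ℝ} (hp : 1 ≤ p) (hq : 1 ≤ q) {n : ℕ} (x : Fin n → E) :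
    BddAbove {r : ℝ | ∃ φ : Fin n → StrongDual ℂ E,
      weakSummingNorm p φ ≤ 1 ∧ r = (∑ i, ‖φ i (x i)‖ ^ q) ^ (1 / q)} := by
  refine ⟨(∑ i, ‖x i‖ ^ q) ^ (1 / q), ?_⟩
  rintro r ⟨φ, hφ, rfl⟩
  refine Real.rpow_le_rpow (by positivity) (Finset.sum_le_sum fun i _ => ?_) (by positivity)
  refine Real.rpow_le_rpow (by positivity) ?_ (by positivity)
  simpa using (φ i).le_of_opNorm_le ((norm_le_weakSummingNorm hp φ i).trans hφ) (x i)

end MultiNorm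

section Group

variable {G : Type*} [Group G] [TopologicalSpace G] [IsTopologicalGroup G]
  [MeasurableSpace G] [BorelSpace G]

/-- Left translation on `L¹(G)`: `(s · f)(t) = f(s⁻¹ t)`. -/
def leftTranslate (m : Measure G) [m.IsMulLeftInvariant] (s : G) :
    Lp ℂ 1 m →L[ℂ] Lp ℂ 1 m :=
  (Lp.compMeasurePreservingₗᵢ ℂ (fun t : G => s⁻¹ * t)
    (measurePreserving_mul_left m s⁻¹)).toContinuousLinearMap

/-- The action of `G` on `L¹(G)''` as second adjoint of left translation:
`⟨φ, s · Λ⟩ = ⟨φ ∘ (s · ), Λ⟩` for `φ ∈ L¹(G)'`. -/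
def bidualTranslate (m : Measure G) [m.IsMulLeftInvariant] (s : G)
    (Λ : StrongDual ℂ (StrongDual ℂ (Lp ℂ 1 m))) :
    StrongDual ℂ (StrongDual ℂ (Lp ℂ 1 m)) :=
  Λ.comp ((ContinuousLinearMap.compL ℂ (Lp ℂ 1 m) (Lp ℂ 1 m) ℂ).flip (leftTranslate m s))

/-- `Λ ∈ L¹(G)''` is a mean if `⟨1, Λ⟩ = ‖Λ‖ = 1`, where `1 ∈ L¹(G)'` is the functional
`f ↦ ∫ f dm`. -/
def IsMean (m : Measure G) (Λ : StrongDual ℂ (StrongDual ℂ (Lp ℂ 1 m))) : Prop :=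
  Λ (L1.integralCLM' ℂ) = 1 ∧ ‖Λ‖ = 1

/-- `G` (with left Haar measure `m`) is `(p,q)`-amenable, `1 ≤ p ≤ q < ∞`, if there is a mean
`Λ ∈ L¹(G)''` whose orbit `{s · Λ : s ∈ G}` is multi-bounded in the weak `(p,q)`-multi-norm
over `L¹(G)''`. -/
def IsPQAmenable (m : Measure G) [m.IsMulLeftInvariant] (p q : ℝ) : Prop :=
  ∃ Λ : StrongDual ℂ (StrongDual ℂ (Lp ℂ 1 m)),
    IsMean m Λ ∧ MultiNorm.IsMultiBounded p q (Set.range fun s : G => bidualTranslate m s Λ)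

end Group

end

/-! For `F = {s₁, …, sₙ}` and `a = C n^{1-1/q}` it suffices to find a density `f` for which the
maximum of the `|sᵢ · f|` has `L¹` norm below `a`. By the layer-cake formula this norm is `∫ m(F
A_t) dt` with `A_t = {|f| > t}`, while `∫ m(A_t) dt = 1`, so some `A_t` has `m(F A_t) < a m(A_t)`;
inner regularity replaces it by a compact set.

If no such `f` exists, Hahn–Banach separates the tuples `(sᵢ · f)` from the ball of radius `a` in
`L¹(G, ℓ^∞_n)` (`exists_mem_densities_norm_orbitMap_lt`). The components of the separating
functional, once rescaled, are admissible in the `(1,q)`-multi-norm. Since a mean obeys every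
half-space bound valid on densities (`IsMean.le_re_apply`), pairing them with the `sᵢ · Λ` and
applying Hölder contradicts the bound on the orbit. Part (ii) follows from `n^{1-1/q} = o(n)`. -/

namespace MultiNorm

variable {E : Type*} [NormedAddCommGroup E] [NormedSpace ℂ E]

/-- The weak `1`-summing norm of a tuple of functionals is at most one if all combinations with
coefficients in the unit disc have norm at most one. -/
lemma weakSummingNorm_one_le {n : ℕ} (φ : Fin n → E)
    (hφ : ∀ c : Fin n → ℂ, (∀ i, ‖c i‖ ≤ 1) → ‖∑ i, c i • φ i‖ ≤ 1) :
    weakSummingNorm 1 φ ≤ 1 := by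
  refine Real.sSup_le ?_ zero_le_one
  rintro r ⟨Φ, hΦ, rfl⟩
  -- Aligning phases turns the sum of moduli into a single value of `Φ`.
  have hc : ∀ z : ℂ, ∃ c : ℂ, ‖c‖ ≤ 1 ∧ c * z = ‖z‖ := fun z => by
    rcases eq_or_ne z 0 with rfl | hz
    · exact ⟨0, by simp, by simp⟩
    · refine ⟨(‖z‖ : ℂ) / z, ?_, div_mul_cancel₀ _ hz⟩
      rw [norm_div, Complex.norm_real, norm_norm, div_self (norm_ne_zero_iff.2 hz)]
  choose c hc1 hc2 using hc
  have h1 : ((∑ i, ‖Φ (φ i)‖ : ℝ) : ℂ) = Φ (∑ i, c (Φ (φ i)) • φ i) := by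
    simp [map_sum, map_smul, hc2]
  have h2 := Φ.le_of_opNorm_le_of_le hΦ (hφ _ fun i => hc1 (Φ (φ i)))
  rw [← h1, Complex.norm_real, Real.norm_of_nonneg (by positivity)] at h2
  simpa using h2

/-- Pairing a tuple with functionals all of whose combinations with coefficients in the unit disc
have norm at most one. -/
lemma sum_norm_apply_le_weakMultiNorm {q : ℝ} (hq : 1 < q) {n : ℕ}
    (x : Fin n → E) (φ : Fin n → StrongDual ℂ E)
    (hφ : ∀ c : Fin n → ℂ, (∀ i, ‖c i‖ ≤ 1) → ‖∑ i, c i • φ i‖ ≤ 1) :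
    ∑ i, ‖φ i (x i)‖ ≤ (n : ℝ) ^ (1 - 1 / q) * weakMultiNorm 1 q x := by
  have hq0 : 0 < q := by linarith
  have hle : (∑ i, ‖φ i (x i)‖ ^ q) ^ (1 / q) ≤ weakMultiNorm 1 q x :=
    le_csSup (bddAbove_weakMultiNorm le_rfl hq.le x) ⟨φ, weakSummingNorm_one_le φ hφ, rfl⟩
  refine le_trans ?_ (mul_le_mul_of_nonneg_left hle (by positivity))
  -- Hölder: `(∑ aᵢ)^q ≤ n^{q-1} ∑ aᵢ^q`.
  have hpow := Real.rpow_sum_le_const_mul_sum_rpow_of_nonneg (s := Finset.univ)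
    (f := fun i => ‖φ i (x i)‖) hq.le (fun i _ => norm_nonneg _)
  have hS : 0 ≤ ∑ i, ‖φ i (x i)‖ := by positivity
  have h3 := Real.rpow_le_rpow (by positivity) hpow (by positivity : 0 ≤ 1 / q)
  rw [← Real.rpow_mul hS, mul_one_div_cancel hq0.ne', Real.rpow_one,
    Real.mul_rpow (by positivity) (by positivity), ← Real.rpow_mul (by positivity)] at h3
  have h4 : (q - 1) * (1 / q) = 1 - 1 / q := by field_simp
  rw [h4] at h3
  simpa using h3

end MultiNorm

/-! ### Densities and means -/

section Densities

variable {α : Type*} [MeasurableSpace α] {m : Measure α}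

/-- The functions of `L¹` that are nonnegative almost everywhere and have integral one. -/
def densities (m : Measure α) : Set (Lp ℂ 1 m) :=
  {f | (∀ᵐ x ∂m, (f x).im = 0 ∧ 0 ≤ (f x).re) ∧ L1.integralCLM' ℂ f = 1}

lemma convex_densities : Convex ℝ (densities m) := by
  rintro f ⟨hf, hf1⟩ g ⟨hg, hg1⟩ a b ha hb hab
  refine ⟨?_, ?_⟩
  · filter_upwards [hf, hg, Lp.coeFn_add (a • f) (b • g), Lp.coeFn_smul a f, Lp.coeFn_smul b g]
      with x h1 h2 h3 h4 h5
    rw [h3, Pi.add_apply, h4, h5]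
    simp only [Pi.smul_apply, Complex.add_im, Complex.add_re, Complex.smul_im, Complex.smul_re,
      smul_eq_mul, h1.1, h2.1]
    exact ⟨by simp, add_nonneg (mul_nonneg ha h1.2) (mul_nonneg hb h2.2)⟩
  · have : a • f + b • g = (a : ℂ) • f + (b : ℂ) • g := rfl
    rw [this, map_add, map_smul, map_smul, hf1, hg1]
    simp [← Complex.ofReal_add, hab]

lemma integralCLM'_apply (f : Lp ℂ 1 m) : L1.integralCLM' ℂ f = ∫ x, f x ∂m := by
  rw [← L1.integral_eq', L1.integral_eq_integral]

lemma norm_eq_one_of_mem_densities {f : Lp ℂ 1 m} (hf : f ∈ densities m) : ‖f‖ = 1 := by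
  have h := hf.2
  rw [integralCLM'_apply] at h
  have h2 : ∫ x, f x ∂m = ∫ x, ((‖f x‖ : ℝ) : ℂ) ∂m := by
    refine integral_congr_ae ?_
    filter_upwards [hf.1] with x hx
    have h3 : f x = ((f x).re : ℂ) := Complex.ext rfl (by simp [hx.1])
    conv_rhs => rw [h3]
    rw [Complex.norm_real, Real.norm_of_nonneg hx.2, ← h3]
  rw [h2, integral_complex_ofReal] at h
  rw [L1.norm_eq_integral_norm]
  exact_mod_cast h

/-- A functional on `L¹` is bounded by its bound on the densities. -/
lemma norm_le_of_norm_apply_densities_le (η : StrongDual ℂ (Lp ℂ 1 m)) {c : ℝ} (hc : 0 ≤ c)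
    (h : ∀ f ∈ densities m, ‖η f‖ ≤ c) : ‖η‖ ≤ c := by
  refine η.opNorm_le_bound hc ?_
  refine Lp.induction ENNReal.one_ne_top _ ?_ ?_ ?_
  · intro a A hA hmA
    rw [Lp.simpleFunc.coe_indicatorConst]
    rcases eq_or_ne (m A) 0 with h0 | h0
    · have : indicatorConstLp 1 hA hmA.ne a = 0 := by
        rw [← norm_eq_zero, norm_indicatorConstLp one_ne_zero ENNReal.one_ne_top]
        simp [Measure.real, h0]
      simp [this]
    · have hr : 0 < m.real A := ENNReal.toReal_pos h0 hmA.ne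
      have hmem : indicatorConstLp 1 hA hmA.ne (((m.real A)⁻¹ : ℝ) : ℂ) ∈ densities m := by
        refine ⟨?_, ?_⟩
        · filter_upwards [indicatorConstLp_coeFn (p := 1) (hs := hA) (hμs := hmA.ne)
            (c := (((m.real A)⁻¹ : ℝ) : ℂ))] with x hx
          rw [hx]
          by_cases hxA : x ∈ A
          · simp only [Set.indicator_of_mem hxA, Complex.ofReal_im, Complex.ofReal_re, true_and]
            positivity
          · simp [Set.indicator_of_notMem hxA]
        · rw [integralCLM'_apply, integral_indicatorConstLp]
          rw [Complex.real_smul, ← Complex.ofReal_mul, mul_inv_cancel₀ hr.ne', Complex.ofReal_one]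
      have hsmul : indicatorConstLp 1 hA hmA.ne a = (m.real A * a) •
          indicatorConstLp 1 hA hmA.ne (((m.real A)⁻¹ : ℝ) : ℂ) := by
        ext1
        filter_upwards [indicatorConstLp_coeFn (p := 1) (hs := hA) (hμs := hmA.ne)
            (c := (((m.real A)⁻¹ : ℝ) : ℂ)), indicatorConstLp_coeFn (p := 1) (hs := hA)
            (hμs := hmA.ne) (c := a), Lp.coeFn_smul (m.real A * a)
            (indicatorConstLp 1 hA hmA.ne (((m.real A)⁻¹ : ℝ) : ℂ))] with x h1 h2 h3
        rw [h3, Pi.smul_apply, h1, h2]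
        by_cases hxA : x ∈ A
        · have : (m.real A : ℂ) ≠ 0 := by exact_mod_cast hr.ne'
          simp only [Set.indicator_of_mem hxA, smul_eq_mul, Complex.ofReal_inv]
          field_simp
        · simp [Set.indicator_of_notMem hxA]
      rw [hsmul, map_smul, norm_smul, norm_smul, norm_eq_one_of_mem_densities hmem, mul_one,
        mul_comm]
      exact mul_le_mul_of_nonneg_right (h _ hmem) (norm_nonneg _)
  · intro f g hf hg hfg h1 h2
    -- The `L¹` norm is additive over disjoint supports, so the bound passes to sums.
    have hnorm : ‖hf.toLp f + hg.toLp g‖ = ‖hf.toLp f‖ + ‖hg.toLp g‖ := by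
      rw [L1.norm_eq_integral_norm, L1.norm_eq_integral_norm, L1.norm_eq_integral_norm,
        ← integral_add (L1.integrable_coeFn _).norm (L1.integrable_coeFn _).norm]
      refine integral_congr_ae ?_
      filter_upwards [hf.coeFn_toLp, hg.coeFn_toLp, Lp.coeFn_add (hf.toLp f) (hg.toLp g)]
        with x h3 h4 h5
      rw [h5, Pi.add_apply, h3, h4]
      by_cases hx : f x = 0
      · simp [hx]
      · have : g x = 0 := by
          by_contra hgx
          exact Set.disjoint_left.1 hfg (Function.mem_support.2 hx) (Function.mem_support.2 hgx)
        simp [this]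
    rw [map_add, hnorm, mul_add]
    exact (norm_add_le _ _).trans (add_le_add h1 h2)
  · exact isClosed_le (by fun_prop) (by fun_prop)

/-- A mean lies in every closed half-space of the weak-star topology containing the densities. -/
lemma IsMean.le_re_apply {Λ : StrongDual ℂ (StrongDual ℂ (Lp ℂ 1 m))} (hΛ : IsMean m Λ)
    (ψ : StrongDual ℂ (Lp ℂ 1 m)) {a : ℝ} (h : ∀ f ∈ densities m, a ≤ (ψ f).re) :
    a ≤ (Λ ψ).re := by
  set x := (Λ ψ).re
  -- Test `Λ` on `R·1 - ψ`, whose norm can be read off on densities. For large `R` the terms linear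
  -- in `R` force `a ≤ x`.
  have key : ∀ R : ℝ, ‖ψ‖ ≤ R → x ≤ R → (R - x) ^ 2 ≤ (R - a) ^ 2 + ‖ψ‖ ^ 2 := by
    intro R hR hxR
    have h1 : ‖(R : ℂ) • (L1.integralCLM' ℂ : StrongDual ℂ (Lp ℂ 1 m)) - ψ‖ ≤ √((R - a) ^ 2 + ‖ψ‖ ^ 2) := by
      refine norm_le_of_norm_apply_densities_le _ (Real.sqrt_nonneg _) fun f hf => ?_
      have hψf : ‖ψ f‖ ≤ ‖ψ‖ := by
        simpa [norm_eq_one_of_mem_densities hf] using ψ.le_opNorm f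
      have hre : (ψ f).re ≤ ‖ψ‖ := (Complex.re_le_norm _).trans hψf
      have him : |(ψ f).im| ≤ |‖ψ‖| :=
        ((Complex.abs_im_le_norm _).trans hψf).trans (le_abs_self _)
      have ha := h f hf
      have : ((R : ℂ) • (L1.integralCLM' ℂ : StrongDual ℂ (Lp ℂ 1 m)) - ψ) f = R - ψ f := by
        simp [hf.2]
      rw [this, Complex.norm_eq_sqrt_sq_add_sq]
      refine Real.sqrt_le_sqrt (add_le_add ?_ ?_)
      · simp only [Complex.sub_re, Complex.ofReal_re]
        exact pow_le_pow_left₀ (by linarith) (by linarith) 2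
      · simp only [Complex.sub_im, Complex.ofReal_im, zero_sub, neg_sq]
        exact sq_le_sq.2 him
    have h2 : Λ ((R : ℂ) • (L1.integralCLM' ℂ : StrongDual ℂ (Lp ℂ 1 m)) - ψ) = R - Λ ψ := by
      rw [map_sub, map_smul, hΛ.1]; simp
    have h3 := Λ.le_of_opNorm_le_of_le hΛ.2.le h1
    rw [h2, one_mul] at h3
    have h4 : R - x ≤ √((R - a) ^ 2 + ‖ψ‖ ^ 2) := by
      refine le_trans ?_ h3
      simpa [x] using Complex.re_le_norm (R - Λ ψ)
    exact (Real.le_sqrt (by linarith) (by positivity)).1 h4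
  by_contra! hlt
  set d := a - x with hd
  have hd0 : 0 < d := by linarith
  set R := max (max ‖ψ‖ x) ((a ^ 2 + ‖ψ‖ ^ 2 + 1) / (2 * d)) with hRdef
  have hR := key R ((le_max_left _ _).trans (le_max_left _ _))
    ((le_max_right _ _).trans (le_max_left _ _))
  have h5 : a ^ 2 + ‖ψ‖ ^ 2 + 1 ≤ R * (2 * d) := (div_le_iff₀ (by positivity)).1 (le_max_right _ _)
  nlinarith [sq_nonneg x]

end Densities

/-! ### Separation in the `ℓ^∞_n`-valued `L¹` space -/

section Orbit

variable {G : Type*} [Group G] [TopologicalSpace G] [IsTopologicalGroup G]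
  [MeasurableSpace G] [BorelSpace G] {m : Measure G} [m.IsMulLeftInvariant]

/-- The map `f ↦ (s₁ · f, …, sₙ · f)` from `L¹(G)` to the `ℂⁿ`-valued `L¹` space, where `ℂⁿ`
carries the maximum norm. -/
noncomputable def orbitMap (m : Measure G) [m.IsMulLeftInvariant] {n : ℕ} (s : Fin n → G) :
    Lp ℂ 1 m →L[ℂ] Lp (Fin n → ℂ) 1 m :=
  ∑ i, ((ContinuousLinearMap.single ℂ (fun _ : Fin n => ℂ) i).compLpL 1 m).comp
    (leftTranslate m (s i))

lemma coeFn_orbitMap {n : ℕ} (s : Fin n → G) (f : Lp ℂ 1 m) :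
    orbitMap m s f =ᵐ[m] fun x i => f ((s i)⁻¹ * x) := by
  have h1 : ∀ i, (ContinuousLinearMap.single ℂ (fun _ : Fin n => ℂ) i).compLpL 1 m
      (leftTranslate m (s i) f) =ᵐ[m] fun x => Pi.single i (f ((s i)⁻¹ * x)) := fun i => by
    filter_upwards [(ContinuousLinearMap.single ℂ (fun _ : Fin n => ℂ) i).coeFn_compLpL (p := 1)
      (μ := m) (leftTranslate m (s i) f), Lp.coeFn_compMeasurePreserving f
      (measurePreserving_mul_left m (s i)⁻¹)] with x h2 h3
    rw [h2]
    exact congrArg (Pi.single i) h3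
  have h2 : orbitMap m s f = ∑ i, (ContinuousLinearMap.single ℂ (fun _ : Fin n => ℂ) i).compLpL 1 m
      (leftTranslate m (s i) f) := by
    simp [orbitMap]
  rw [h2]
  have h3 := Lp.coeFn_fun_finsetSum (Finset.univ : Finset (Fin n)) fun i =>
    (ContinuousLinearMap.single ℂ (fun _ : Fin n => ℂ) i).compLpL 1 m (leftTranslate m (s i) f)
  filter_upwards [h3, ae_all_iff.2 h1] with x h4 h5
  rw [h4]
  ext i
  simp only [h5, Finset.sum_apply, Finset.sum_pi_single, Finset.mem_univ, if_true]

/-- The components of a functional on the `ℂⁿ`-valued `L¹` space: all their combinations with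
coefficients in the unit disc are bounded by its norm. -/
lemma norm_sum_smul_comp_single_le {α : Type*} [MeasurableSpace α] {μ : Measure α} {n : ℕ}
    (φ : StrongDual ℂ (Lp (Fin n → ℂ) 1 μ)) (c : Fin n → ℂ) (hc : ∀ i, ‖c i‖ ≤ 1) :
    ‖∑ i, c i • φ.comp ((ContinuousLinearMap.single ℂ (fun _ : Fin n => ℂ) i).compLpL 1 μ)‖
      ≤ ‖φ‖ := by
  -- The combination is `φ` after `z ↦ (cᵢ z)`, a contraction into `ℓ^∞_n`.
  set L : ℂ →L[ℂ] (Fin n → ℂ) := ContinuousLinearMap.pi fun i => c i • ContinuousLinearMap.id ℂ ℂ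
  have hL : ‖L‖ ≤ 1 := by
    refine L.opNorm_le_bound zero_le_one fun z => ?_
    rw [one_mul, pi_norm_le_iff_of_nonneg (norm_nonneg _)]
    intro i
    simpa [L] using mul_le_of_le_one_left (norm_nonneg z) (hc i)
  have hsum : ∑ i, c i • φ.comp
      ((ContinuousLinearMap.single ℂ (fun _ : Fin n => ℂ) i).compLpL 1 μ) =
      φ.comp (L.compLpL 1 μ) := by
    ext f
    have h1 : L.compLpL 1 μ f = ∑ i, c i •
        (ContinuousLinearMap.single ℂ (fun _ : Fin n => ℂ) i).compLpL 1 μ f := by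
      ext1
      have h3 := Lp.coeFn_fun_finsetSum (Finset.univ : Finset (Fin n)) fun i =>
        c i • (ContinuousLinearMap.single ℂ (fun _ : Fin n => ℂ) i).compLpL 1 μ f
      filter_upwards [L.coeFn_compLpL (p := 1) (μ := μ) f, h3,
        ae_all_iff.2 fun i => Lp.coeFn_smul (c i)
          ((ContinuousLinearMap.single ℂ (fun _ : Fin n => ℂ) i).compLpL 1 μ f),
        ae_all_iff.2 fun i => (ContinuousLinearMap.single ℂ (fun _ : Fin n => ℂ) i).coeFn_compLpL
          (p := 1) (μ := μ) f] with x h4 h5 h6 h7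
      rw [h4, h5]
      ext j
      simp [h6, h7, L, Finset.sum_apply, Pi.single_apply]
    simp [h1, map_sum]
  rw [hsum]
  refine (φ.opNorm_comp_le _).trans (mul_le_of_le_one_right (norm_nonneg _) ?_)
  refine ContinuousLinearMap.opNorm_le_bound _ zero_le_one fun f => ?_
  exact (L.norm_compLp_le f).trans (mul_le_mul_of_nonneg_right hL (norm_nonneg _))

/-- If the orbit of a mean has bounded weak `(1,q)`-multi-norm, then some density has translates
whose maximum has small norm in `L¹`. -/
lemma exists_mem_densities_norm_orbitMap_lt {q : ℝ} (hq : 1 < q)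
    {Λ : StrongDual ℂ (StrongDual ℂ (Lp ℂ 1 m))} (hΛ : IsMean m Λ) {n : ℕ} (s : Fin n → G) {a : ℝ}
    (ha : 0 < a) (h : (n : ℝ) ^ (1 - 1 / q) *
      MultiNorm.weakMultiNorm 1 q (fun i => bidualTranslate m (s i) Λ) < a) :
    ∃ f ∈ densities m, ‖orbitMap m s f‖ < a := by
  by_contra! hcon
  -- With `b < a` the closed `b`-ball lies in the separated open ball, giving `‖φ‖ ≤ u / b`.
  obtain ⟨b, hb, hba⟩ := exists_between (max_lt ha h)
  obtain ⟨hb0, hb⟩ := max_lt_iff.1 hb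
  have hconv : Convex ℝ (orbitMap m s '' densities m) :=
    (convex_densities (m := m)).is_linear_image
      ((orbitMap m s).toLinearMap.restrictScalars ℝ).isLinear
  have hdisj : Disjoint (Metric.ball (0 : Lp (Fin n → ℂ) 1 m) a) (orbitMap m s '' densities m) := by
    rw [Set.disjoint_left]
    rintro _ hg ⟨f, hf, rfl⟩
    exact (hcon f hf).not_gt (mem_ball_zero_iff.1 hg)
  obtain ⟨φ, u, hφ1, hφ2⟩ := RCLike.geometric_hahn_banach_open (𝕜 := ℂ) (convex_ball _ _)
    Metric.isOpen_ball hconv hdisj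
  have hu : 0 < u := by simpa using hφ1 0 (Metric.mem_ball_self ha)
  have hφ : ‖φ‖ ≤ u / b := by
    refine ContinuousLinearMap.opNorm_bound_of_ball_bound hb0 u φ fun g hg => ?_
    -- Rotating `g` upgrades the bound on the real part to one on the modulus.
    obtain ⟨c, hc, hcg⟩ := RCLike.exists_norm_eq_mul_self (φ g)
    have h1 := hφ1 (c • g) (by
      rw [mem_ball_zero_iff, norm_smul, hc, one_mul]
      exact (mem_closedBall_zero_iff.1 hg).trans_lt hba)
    rw [map_smul, smul_eq_mul, ← hcg] at h1
    simpa using h1.le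
  set ψ : Fin n → StrongDual ℂ (Lp ℂ 1 m) := fun i =>
    φ.comp ((ContinuousLinearMap.single ℂ (fun _ : Fin n => ℂ) i).compLpL 1 m) with hψ
  have hsum := MultiNorm.sum_norm_apply_le_weakMultiNorm hq
    (fun i => bidualTranslate m (s i) Λ)
    (fun i => NormedSpace.inclusionInDoubleDual ℂ (StrongDual ℂ (Lp ℂ 1 m))
      (((b / u : ℝ) : ℂ) • ψ i)) (fun c hc => by
      have h1 : ∑ i, c i • NormedSpace.inclusionInDoubleDual ℂ (StrongDual ℂ (Lp ℂ 1 m))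
          (((b / u : ℝ) : ℂ) • ψ i) = NormedSpace.inclusionInDoubleDual ℂ
            (StrongDual ℂ (Lp ℂ 1 m)) (((b / u : ℝ) : ℂ) • ∑ i, c i • ψ i) := by
        simp only [Finset.smul_sum, map_sum, map_smul]
        exact Finset.sum_congr rfl fun i _ => smul_comm _ _ _
      rw [h1]
      refine (NormedSpace.double_dual_bound ℂ _ _).trans ?_
      rw [norm_smul, Complex.norm_real, Real.norm_of_nonneg (by positivity)]
      calc b / u * ‖∑ i, c i • ψ i‖ ≤ b / u * (u / b) :=
            mul_le_mul_of_nonneg_left ((norm_sum_smul_comp_single_le φ c hc).trans hφ)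
              (by positivity)
        _ = 1 := by field_simp)
  have hre := hΛ.le_re_apply (φ.comp (orbitMap m s)) (a := u) fun f hf =>
    hφ2 _ (Set.mem_image_of_mem _ hf)
  have hdecomp : φ.comp (orbitMap m s) = ∑ i, (ψ i).comp (leftTranslate m (s i)) := by
    ext f
    simp [orbitMap, hψ, map_sum]
  have hle : (b / u) * u ≤ ∑ i, ‖NormedSpace.inclusionInDoubleDual ℂ (StrongDual ℂ (Lp ℂ 1 m))
      (((b / u : ℝ) : ℂ) • ψ i) (bidualTranslate m (s i) Λ)‖ := by
    calc (b / u) * u ≤ (b / u) * ‖Λ (φ.comp (orbitMap m s))‖ :=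
          mul_le_mul_of_nonneg_left (hre.trans (Complex.re_le_norm _)) (by positivity)
      _ ≤ (b / u) * ∑ i, ‖Λ ((ψ i).comp (leftTranslate m (s i)))‖ := by
          rw [hdecomp, map_sum]
          exact mul_le_mul_of_nonneg_left (norm_sum_le _ _) (by positivity)
      _ = _ := by
          rw [Finset.mul_sum]
          refine Finset.sum_congr rfl fun i _ => ?_
          rw [NormedSpace.dual_def, map_smul, norm_smul, Complex.norm_real,
            Real.norm_of_nonneg (by positivity)]
          rfl
  rw [div_mul_cancel₀ _ hu.ne'] at hle
  linarith

end Orbit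

/-! ### Level sets of the maximal function -/

section LevelSets

/-- A maximum exceeds `t` exactly when one entry does. For `n = 0` this needs `t ≥ 0`, as the empty
maximum is `0`. -/
lemma setOf_lt_norm_translates {G : Type*} [Group G] {n : ℕ} (s : Fin n → G)
    (f : G → ℂ) {t : ℝ} (ht : 0 ≤ t) :
    {x | t < ‖fun i => f ((s i)⁻¹ * x)‖} = Set.range s * {x | t < ‖f x‖} := by
  ext x
  rw [Set.mem_ofPred_eq, ← not_le, pi_norm_le_iff_of_nonneg ht]
  push Not
  constructor
  · rintro ⟨i, hi⟩
    exact ⟨s i, ⟨i, rfl⟩, (s i)⁻¹ * x, hi, by simp⟩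
  · rintro ⟨_, ⟨i, rfl⟩, y, hy, rfl⟩
    exact ⟨i, by simpa using hy⟩

variable {G : Type*} [Group G] [TopologicalSpace G] [IsTopologicalGroup G]
  [MeasurableSpace G] [BorelSpace G] {m : Measure G}

/-- If the maximum of the translates of `f` has norm less than `a‖f‖`, then some level set of `f`
satisfies the corresponding Følner-type inequality. -/
lemma exists_level_measure_mul_lt [m.IsMulLeftInvariant] {n : ℕ} (s : Fin n → G) (f : Lp ℂ 1 m) {a : ℝ} (ha : 0 ≤ a)
    (h : ‖orbitMap m s f‖ < a * ‖f‖) :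
    ∃ t : ℝ, 0 < t ∧ m (Set.range s * {x | t < ‖f x‖}) < ENNReal.ofReal a * m {x | t < ‖f x‖} := by
  by_contra! hcon
  have hmeas : Measurable f := (Lp.stronglyMeasurable f).measurable
  set g : G → ℝ := fun x => ‖fun i => f ((s i)⁻¹ * x)‖
  have hgm : Measurable g := by fun_prop
  have h1 : ENNReal.ofReal ‖orbitMap m s f‖ = ∫⁻ x, ENNReal.ofReal (g x) ∂m := by
    rw [L1.norm_eq_integral_norm, ofReal_integral_eq_lintegral_ofReal
      (L1.integrable_coeFn _).norm (.of_forall fun _ => norm_nonneg _)]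
    refine lintegral_congr_ae ?_
    filter_upwards [coeFn_orbitMap s f] with x hx
    rw [hx]
  have h2 : ENNReal.ofReal ‖f‖ = ∫⁻ x, ENNReal.ofReal ‖f x‖ ∂m := by
    rw [L1.norm_eq_integral_norm, ofReal_integral_eq_lintegral_ofReal
      (L1.integrable_coeFn _).norm (.of_forall fun _ => norm_nonneg _)]
  -- Layer cake for both norms; the assumed reverse inequality is then integrated over `t > 0`.
  rw [lintegral_eq_lintegral_meas_lt m (.of_forall fun _ => norm_nonneg _) hgm.aemeasurable] at h1
  rw [lintegral_eq_lintegral_meas_lt m (.of_forall fun _ => norm_nonneg _)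
    hmeas.norm.aemeasurable] at h2
  refine h.not_ge ((ENNReal.ofReal_le_ofReal_iff (norm_nonneg _)).1 ?_)
  rw [ENNReal.ofReal_mul ha, h1, h2, ← lintegral_const_mul' _ _ ENNReal.ofReal_ne_top]
  refine setLIntegral_mono' measurableSet_Ioi fun t ht => ?_
  rw [setOf_lt_norm_translates s f (le_of_lt ht)]
  exact hcon t ht

end LevelSets

/-- A Følner-type inequality for a measurable set of finite measure passes to a compact subset. -/
lemma exists_isCompact_measure_mul_le {G : Type*} [Group G] [TopologicalSpace G]
    [MeasurableSpace G] {m : Measure G} [m.Regular] (F : Set G) {A : Set G} (hA : MeasurableSet A)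
    (hmA : m A ≠ ⊤) {a : ℝ} (ha : 0 < a) (h : m (F * A) < ENNReal.ofReal a * m A) :
    ∃ S : Set G, IsCompact S ∧ m S ≠ 0 ∧ m.real (F * S) / m.real S ≤ a := by
  have ha' : ENNReal.ofReal a ≠ 0 := by simpa using ha
  -- A compact `K ⊆ A` with `m K > m (F * A) / a` works, since `F * K ⊆ F * A`.
  have hr : m (F * A) / ENNReal.ofReal a < m A :=
    ENNReal.div_lt_of_lt_mul' h
  obtain ⟨K, hKA, hK, hlt⟩ := hA.exists_lt_isCompact_of_ne_top hmA hr
  have hK0 : m K ≠ 0 := (zero_le.trans_lt hlt).ne'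
  refine ⟨K, hK, hK0, ?_⟩
  have hKtop : m K ≠ ⊤ := hK.measure_lt_top.ne
  have hle : m (F * K) ≤ ENNReal.ofReal a * m K := by
    refine (measure_mono (Set.mul_subset_mul_left hKA)).trans ?_
    rw [mul_comm]
    exact (ENNReal.div_le_iff ha' ENNReal.ofReal_ne_top).1 hlt.le
  rw [div_le_iff₀ (show 0 < m.real K from ENNReal.toReal_pos hK0 hKtop)]
  have := ENNReal.toReal_mono (ENNReal.mul_ne_top ENNReal.ofReal_ne_top hKtop) hle
  rwa [ENNReal.toReal_mul, ENNReal.toReal_ofReal ha.le] at this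


/-- A `(1,q)`-amenable group satisfies a Følner-type condition with exponent `1 - 1/q`. -/
lemma IsPQAmenable.exists_isCompact_measure_mul_le {G : Type*} [Group G] [TopologicalSpace G]
    [IsTopologicalGroup G] [LocallyCompactSpace G] [MeasurableSpace G] [BorelSpace G]
    {m : Measure G} [m.IsHaarMeasure] [m.Regular] {q : ℝ} (hq : 1 < q) (hG : IsPQAmenable m 1 q) :
    ∃ C : ℝ, 1 ≤ C ∧ ∀ (n : ℕ) (F : Finset G), F.card = n →
      ∃ S : Set G, IsCompact S ∧ m S ≠ 0 ∧
        m.real ((F : Set G) * S) / m.real S ≤ C * (n : ℝ) ^ (1 - 1 / q) := by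
  obtain ⟨Λ, hΛ, C, hC⟩ := hG
  -- The added `1` gives the lower bound on the constant and makes the multi-norm bound strict.
  refine ⟨max C 0 + 1, by simp, fun n F hF => ?_⟩
  -- For `n = 0` the right side vanishes, but so does the measure of the empty product.
  rcases n.eq_zero_or_pos with rfl | hn
  · obtain ⟨K⟩ : Nonempty (TopologicalSpace.PositiveCompacts G) := inferInstance
    refine ⟨K, K.isCompact, (Measure.measure_pos_of_nonempty_interior m K.interior_nonempty).ne', ?_⟩
    rw [Finset.card_eq_zero.1 hF]
    simp only [Finset.coe_empty, Set.empty_mul, measureReal_empty, zero_div]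
    positivity
  set s : Fin n → G := fun i => ((F.equivFinOfCardEq hF).symm i : G) with hs
  have hrange : Set.range s = F := by
    ext x
    simp only [Set.mem_range, hs, Finset.mem_coe]
    constructor
    · rintro ⟨i, rfl⟩
      exact ((F.equivFinOfCardEq hF).symm i).2
    · exact fun hx => ⟨F.equivFinOfCardEq hF ⟨x, hx⟩, by simp⟩
  have hpow : 0 < (n : ℝ) ^ (1 - 1 / q) := by positivity
  have ha : 0 < (max C 0 + 1) * (n : ℝ) ^ (1 - 1 / q) := by positivity
  have hlt : (n : ℝ) ^ (1 - 1 / q) * MultiNorm.weakMultiNorm 1 q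
      (fun i => bidualTranslate m (s i) Λ) < (max C 0 + 1) * (n : ℝ) ^ (1 - 1 / q) := by
    rw [mul_comm]
    refine mul_lt_mul_of_pos_right ?_ hpow
    have h1 : MultiNorm.weakMultiNorm 1 q (fun i => bidualTranslate m (s i) Λ) ≤ C :=
      hC ⟨n, _, fun i => Set.mem_range_self (s i), rfl⟩
    linarith [le_max_left C 0]
  obtain ⟨f, hf, hfs⟩ := exists_mem_densities_norm_orbitMap_lt hq hΛ s ha hlt
  obtain ⟨t, ht, hlevel⟩ := exists_level_measure_mul_lt s f ha.le
    (by rwa [norm_eq_one_of_mem_densities hf, mul_one])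
  rw [hrange] at hlevel
  exact _root_.exists_isCompact_measure_mul_le _
    (measurableSet_lt measurable_const (Lp.stronglyMeasurable f).measurable.norm)
    ((L1.integrable_coeFn f).measure_norm_gt_lt_top ht).ne ha hlevel

theorem mainTheorem4 {G : Type*} [Group G] [TopologicalSpace G] [IsTopologicalGroup G]
    [LocallyCompactSpace G] [T2Space G] [MeasurableSpace G] [BorelSpace G]
    (m : Measure G) [m.IsHaarMeasure] [m.Regular] (q : ℝ) (hq : 1 < q)
    (hG : IsPQAmenable m 1 q) :
    (∃ C : ℝ, 1 ≤ C ∧ ∀ (n : ℕ) (F : Finset G), F.card = n →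
      ∃ S : Set G, IsCompact S ∧ m S ≠ 0 ∧
        m.real ((F : Set G) * S) / m.real S ≤ C * (n : ℝ) ^ (1 - 1 / q)) ∧
    (∀ ε : ℝ, 0 < ε → ∃ n₀ : ℕ, ∀ n : ℕ, n₀ ≤ n → ∀ F : Finset G, F.card = n →
      ∃ S : Set G, IsCompact S ∧ m S ≠ 0 ∧
        m.real ((F : Set G) * S) / m.real S ≤ ε * (n : ℝ)) := by
  obtain ⟨C, hC1, hC⟩ := hG.exists_isCompact_measure_mul_le hq
  refine ⟨⟨C, hC1, hC⟩, fun ε hε => ?_⟩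
  have hlim : Filter.Tendsto (fun n : ℕ => C * (n : ℝ) ^ (-(1 / q))) Filter.atTop (nhds (C * 0)) :=
    ((tendsto_rpow_neg_atTop (by positivity)).comp tendsto_natCast_atTop_atTop).const_mul C
  rw [mul_zero] at hlim
  obtain ⟨n₀, hn₀⟩ := Filter.eventually_atTop.1 (hlim.eventually_le_const hε)
  refine ⟨max n₀ 1, fun n hn F hF => ?_⟩
  obtain ⟨S, hS, hmS, hle⟩ := hC n F hF
  refine ⟨S, hS, hmS, hle.trans ?_⟩
  have hn0 : (0 : ℝ) < n := by exact_mod_cast (le_max_right n₀ 1).trans hn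
  have h1 : (n : ℝ) ^ (1 - 1 / q) = (n : ℝ) ^ (-(1 / q)) * n := by
    rw [show 1 - 1 / q = -(1 / q) + 1 by ring, Real.rpow_add hn0, Real.rpow_one]
  rw [h1, ← mul_assoc]
  exact mul_le_mul_of_nonneg_right (hn₀ n ((le_max_left _ _).trans hn)) hn0.le
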